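/- A partition (the empty one included) is a $t$-core if no node of its Ferrers diagram has hook length $t$. Let $\mathcal P_{t_1,\dots,t_k}$ be the set of partitions that are $t_i$-cores for every $i$. Let $a,b$ be relatively prime positive integers, and put $$\mathcal Z_{a,b}=\Big\{(z_j)_{j\ge 0}:\ z_j\in\mathbb Z_{\ge 0},\ \sum_{l=j}^{j+a-1}z_l=b\ \text{ and }\ \sum_{l=0}^{j-1}z_l\le \tfrac{jb}{a}\ \text{ for all } j\ge 0\Big\},$$ $$\mathcal Z'_{a,b}=\Big\{(z_j)_{j\ge 0}:\ z_j\in\mathbb Z_{\ge 0},\ \sum_{l=0}^{a-1}z_l=b,\ z_j=z_{r_a(j)}\ \text{ for all } j\ge 0\Big\},$$ where $r_a(j)$ is the remainder of $j$ modulo $a$. Let $n\ge 0$, let $c_1,\dots,c_n$ be positive integers, let $d_i$ be the integer with $1\le d_i\le a$ and $bd_i+c_i\equiv 0\pmod a$, and let $$\mathcal W=\bigcap_{i=1}^{n}\Big\{(z_j)_{j\ge0}:\ \sum_{l=j}^{j+d_i-1}z_l\le \frac{bd_i+c_i}{a}\ \text{ for all } j\ge 0\Big\}.$$ Then there is a bijection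 from $\mathcal P_{a,b,c_1,\dots,c_n}$ to $\mathcal Z_{a,b}\cap\mathcal W$. Explicitly, for a partition $\lambda$ let $x_j=n_j+r_a(j)/a$, where $n_j$ is the number of hook lengths in the first column of the diagram of $\lambda$ that are congruent to $j$ modulo $a$; then $\lambda\mapsto(z_j)_{j\ge0}$ with $z_j=x_{jb}-x_{(j+1)b}+b/a$ is such a bijection. Furthermore, $\mathcal P_{a,b,c_1,\dots,c_n}$ and $\mathcal Z'_{a,b}\cap\mathcal W$ are finite, and $$|\mathcal P_{a,b,c_1,\dots,c_n}|=\frac1a\,\big|\mathcal Z'_{a,b}\cap\mathcal W\big|.$$ -/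

import Mathlib

/-- The hook of the node `c = (i, j)` (row `i`, column `j`, counted from `0`) in the diagram `μ`:
the node itself, the nodes to its right in the same row, the nodes below it in the same column.
Partitions, including the empty one, are represented by their diagrams. -/
def YoungDiagram.hook (μ : YoungDiagram) (c : ℕ × ℕ) : Finset (ℕ × ℕ) :=
  {e ∈ μ.cells | (e.1 = c.1 ∧ c.2 ≤ e.2) ∨ (e.2 = c.2 ∧ c.1 ≤ e.1)}

/-- The hook length of a node: the number of nodes in its hook. -/
def YoungDiagram.hookLength (μ : YoungDiagram) (c : ℕ × ℕ) : ℕ :=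
  (μ.hook c).card

namespace CorePartitions

/-- `𝒫_t`: the partitions whose diagram contains no hook of length `t`. -/
def cores (t : ℕ) : Set YoungDiagram :=
  {μ | ∀ c ∈ μ.cells, μ.hookLength c ≠ t}

/-- `𝒫_{a, b, c₁, …, cₙ}`: the simultaneous core partitions. -/
def simultaneousCores (a b : ℕ) {n : ℕ} (c : Fin n → ℕ) : Set YoungDiagram :=
  cores a ∩ cores b ∩ ⋂ i, cores (c i)

/-- `𝒵_{a, b}`: sequences of nonnegative integers all of whose windows of length `a` sum to `b`,
and whose initial sums satisfy `z₀ + ⋯ + z_{j-1} ≤ j b / a`. -/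
def cZ (a b : ℕ) : Set (ℕ → ℕ) :=
  {z | (∀ j, ∑ l ∈ Finset.Ico j (j + a), z l = b) ∧
    ∀ j, ((∑ l ∈ Finset.range j, z l : ℕ) : ℚ) ≤ (j : ℚ) * b / a}

/-- `𝒵'_{a, b}`: `a`-periodic sequences of nonnegative integers with `z₀ + ⋯ + z_{a-1} = b`. -/
def cZ' (a b : ℕ) : Set (ℕ → ℕ) :=
  {z | ∑ l ∈ Finset.range a, z l = b ∧ ∀ j, z j = z (j % a)}

/-- The sequences such that, for each `i`, every window of `dᵢ` consecutive entries sums to at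
most `(b dᵢ + cᵢ) / a`. -/
def windowBounded (a b : ℕ) {n : ℕ} (c d : Fin n → ℕ) : Set (ℕ → ℕ) :=
  ⋂ i, {z | ∀ j, ((∑ l ∈ Finset.Ico j (j + d i), z l : ℕ) : ℚ) ≤ ((b : ℚ) * d i + c i) / a}

/-- `β(μ)`: the set of hook lengths in the first column of the diagram. -/
def betaSet (μ : YoungDiagram) : Finset ℕ :=
  (μ.col 0).image μ.hookLength

/-- `n_j`: the number of elements of `β(μ)` congruent to `j` modulo `a`. -/
def nCoord (a : ℕ) (μ : YoungDiagram) (j : ℕ) : ℕ :=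
  {x ∈ betaSet μ | x ≡ j [MOD a]}.card

/-- `x_j = n_j + r_a(j) / a`, where `r_a(j)` is the remainder of `j` modulo `a`. -/
def xCoord (a : ℕ) (μ : YoungDiagram) (j : ℕ) : ℚ :=
  nCoord a μ j + ((j % a : ℕ) : ℚ) / a

end CorePartitions

open CorePartitions

/-!
The complement in `ℕ` of the set of first-column hook lengths of an `a`-core contains `0` and is
closed under adding `a`, so it is determined by its least element `Y r` in each class `r` modulo
`a`, and `Y r = a * x_r`. The core is moreover a `c`-core iff `Y (r + c) ≤ Y r + c` for all `r`.
For `c = b` this says that `Y (j * b)`, which starts at `0`, grows by at most `b` at each step;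
recording `z j = (Y (j * b) + b - Y ((j + 1) * b)) / a` makes it the height
`j * b - a * (z 0 + ⋯ + z (j - 1))`. As `b * d + c` vanishes modulo `a`, the inequality for `c`
compares the heights at `j` and `j + d`, so it bounds a window sum of length `d`.

For the count, a sequence of `𝒵'` has `a`-periodic height, congruent to `j * b` modulo `a`; since
`b` is a unit modulo `a`, the minimum over a period is attained exactly once, and exactly one of
the `a` rotations has nonnegative height (the cycle lemma).
-/

namespace CorePartitions

open YoungDiagram Finset

theorem hookLength_eq {μ : YoungDiagram} {i j : ℕ} :
    μ.hookLength (i, j) = (μ.rowLen i - j) + (μ.colLen j - (i + 1)) := by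
  have arm_union_leg : μ.hook (i, j) =
      {i} ×ˢ Ico j (μ.rowLen i) ∪ Ico (i + 1) (μ.colLen j) ×ˢ {j} := by
    ext ⟨x, y⟩
    simp only [hook, mem_filter, mem_cells, mem_union, mem_product, mem_singleton, mem_Ico]
    constructor
    · rintro ⟨hm, ⟨rfl, hy⟩ | ⟨rfl, hx⟩⟩
      · exact Or.inl ⟨rfl, hy, mem_iff_lt_rowLen.1 hm⟩
      · rcases hx.eq_or_lt with rfl | hx
        · exact Or.inl ⟨rfl, le_rfl, mem_iff_lt_rowLen.1 hm⟩
        · exact Or.inr ⟨⟨hx, mem_iff_lt_colLen.1 hm⟩, rfl⟩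
    · rintro (⟨rfl, hy, hm⟩ | ⟨⟨hx, hm⟩, rfl⟩)
      · exact ⟨mem_iff_lt_rowLen.2 hm, Or.inl ⟨rfl, hy⟩⟩
      · exact ⟨mem_iff_lt_colLen.2 hm, Or.inr ⟨rfl, by omega⟩⟩
  have arm_disjoint_leg : Disjoint ({i} ×ˢ Ico j (μ.rowLen i)) (Ico (i + 1) (μ.colLen j) ×ˢ {j}) :=
    disjoint_product.2 (Or.inl (by simp))
  rw [hookLength, arm_union_leg, card_union_of_disjoint arm_disjoint_leg]
  simp

theorem lt_rowLen_iff_lt_colLen {μ : YoungDiagram} {i j : ℕ} :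
    j < μ.rowLen i ↔ i < μ.colLen j :=
  mem_iff_lt_rowLen.symm.trans mem_iff_lt_colLen

theorem mem_betaSet {μ : YoungDiagram} {x : ℕ} :
    x ∈ betaSet μ ↔ ∃ i < μ.colLen 0, x + i + 1 = μ.rowLen i + μ.colLen 0 := by
  simp only [betaSet, col_eq_prod, mem_image, mem_product, Finset.mem_range, mem_singleton,
    Prod.exists, and_assoc, exists_and_left, exists_eq_left, hookLength_eq]
  refine exists_congr fun i => and_congr_right fun hi => ?_
  omega

theorem card_betaSet (μ : YoungDiagram) : (betaSet μ).card = μ.colLen 0 := by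
  rw [betaSet, card_image_of_injOn, ← colLen_eq_card]
  rintro ⟨i, _⟩ hi ⟨k, _⟩ hk hik
  simp only [col_eq_prod, coe_product, Set.mem_prod, mem_coe, Finset.mem_range,
    mem_singleton] at hi hk
  obtain ⟨⟨hi, rfl⟩, hk, rfl⟩ := And.intro hi hk
  simp only [hookLength_eq] at hik
  have := μ.rowLen_anti i k
  have := μ.rowLen_anti k i
  simp only [Prod.mk.injEq, and_true]
  omega

/-- The `j`-th natural number, counted from `0`, that is not a first-column hook length: walking
along the boundary of the diagram, it is the position of the step under column `j`. -/
def gap (μ : YoungDiagram) (j : ℕ) : ℕ :=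
  μ.colLen 0 + j - μ.colLen j

theorem gap_add_colLen (μ : YoungDiagram) (j : ℕ) : gap μ j + μ.colLen j = μ.colLen 0 + j := by
  have := μ.colLen_anti 0 j (Nat.zero_le j)
  unfold gap
  omega

theorem gap_zero (μ : YoungDiagram) : gap μ 0 = 0 := by
  have := gap_add_colLen μ 0
  omega

theorem gap_strictMono (μ : YoungDiagram) : StrictMono (gap μ) := by
  refine strictMono_nat_of_lt_succ fun j => ?_
  have := μ.colLen_anti j (j + 1) (Nat.le_succ j)
  have := gap_add_colLen μ j
  have := gap_add_colLen μ (j + 1)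
  omega

theorem gap_notMem_betaSet (μ : YoungDiagram) (j : ℕ) : gap μ j ∉ betaSet μ := by
  rw [mem_betaSet]
  rintro ⟨i, _, hx⟩
  have := gap_add_colLen μ j
  have := lt_rowLen_iff_lt_colLen (μ := μ) (i := i) (j := j)
  omega

theorem mem_betaSet_of_gap_lt_of_lt_gap {μ : YoungDiagram} {j x : ℕ} (hj : gap μ j < x)
    (hx : x < gap μ (j + 1)) : x ∈ betaSet μ := by
  have hgap := gap_add_colLen μ j
  have hgap' := gap_add_colLen μ (j + 1)
  have hle := μ.colLen_anti 0 j (Nat.zero_le j)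
  have hlt : j < μ.rowLen (μ.colLen 0 + j - x) := lt_rowLen_iff_lt_colLen.2 (by omega)
  have hge : ¬ j + 1 < μ.rowLen (μ.colLen 0 + j - x) := by
    rw [lt_rowLen_iff_lt_colLen]
    omega
  exact mem_betaSet.2 ⟨μ.colLen 0 + j - x, by omega, by omega⟩

theorem notMem_betaSet_iff {μ : YoungDiagram} {x : ℕ} : x ∉ betaSet μ ↔ ∃ j, gap μ j = x := by
  refine ⟨fun hx => ?_, ?_⟩
  · rcases x.eq_zero_or_pos with rfl | hpos
    · exact ⟨0, gap_zero μ⟩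
    obtain ⟨j, hlt, hle⟩ := (gap_strictMono μ).exists_between_of_tendsto_atTop
      (gap_strictMono μ).tendsto_atTop (by rwa [gap_zero])
    exact ⟨j + 1, le_antisymm
      (not_lt.1 fun h => hx (mem_betaSet_of_gap_lt_of_lt_gap hlt h)) hle⟩
  · rintro ⟨j, rfl⟩
    exact gap_notMem_betaSet μ j

theorem range_gap (μ : YoungDiagram) : Set.range (gap μ) = (betaSet μ : Set ℕ)ᶜ :=
  Set.ext fun _ => notMem_betaSet_iff.symm

theorem zero_notMem_betaSet (μ : YoungDiagram) : 0 ∉ betaSet μ :=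
  notMem_betaSet_iff.2 ⟨0, gap_zero μ⟩

theorem betaSet_injective : Function.Injective betaSet := by
  intro μ ν h
  have hgap : gap μ = gap ν := by
    rw [← (gap_strictMono μ).range_inj (gap_strictMono ν), range_gap, range_gap, h]
  have hcol : ∀ j, μ.colLen j = ν.colLen j := fun j => by
    have hμ := gap_add_colLen μ j
    have hν := gap_add_colLen ν j
    rw [← card_betaSet, hgap, h, card_betaSet] at hμ
    omega
  ext ⟨i, j⟩
  rw [mem_cells, mem_cells, mem_iff_lt_colLen, mem_iff_lt_colLen, hcol]

theorem count_add_count_not (p : ℕ → Prop) [DecidablePred p] (n : ℕ) :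
    Nat.count p n + Nat.count (fun x => ¬ p x) n = n := by
  simpa only [Nat.count_eq_card_filter_range, card_range] using
    card_filter_add_card_filter_not (s := range n) p

-- The row that contributes `x` to the first-column hook lengths has as many nodes as there are
-- non-elements of `s` below `x`.
theorem exists_betaSet_eq {s : Finset ℕ} (hs : 0 ∉ s) : ∃ μ, betaSet μ = s := by
  have hcard : ∀ {m}, m < s.card → ∀ hf : (Set.ofPred (· ∈ s)).Finite, m < #hf.toFinset := by
    intro m hm hf
    convert hm
    ext; simp
  set e : ℕ → ℕ := Nat.nth (· ∈ s)
  have he : ∀ {m}, m < s.card → e m ∈ s := fun hm => Nat.nth_mem _ (hcard hm)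
  set w : List ℕ := List.ofFn fun i : Fin s.card => Nat.count (· ∉ s) (e i.rev) with hw
  have hsorted : w.SortedGE := List.sortedGE_ofFn_iff.2 fun i k hik =>
    Nat.count_monotone _ (Nat.nth_le_nth' (Fin.rev_le_rev.2 hik) (hcard i.rev.isLt))
  have hpos : ∀ r ∈ w, 0 < r := by
    simp only [hw, List.forall_mem_ofFn_iff]
    intro i
    have hne : 0 < e i.rev := Nat.pos_of_ne_zero fun h => hs (h ▸ he i.rev.isLt)
    simpa using Nat.count_strict_mono (p := (· ∉ s)) hs hne
  have hlen : (ofRowLens w hsorted).colLen 0 = s.card := by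
    rw [← length_rowLens, rowLens_length_ofRowLens hpos, List.length_ofFn]
  refine ⟨ofRowLens w hsorted, eq_of_subset_of_card_le (fun x hx => ?_) ?_⟩
  · obtain ⟨i, hi, hx⟩ := mem_betaSet.1 hx
    rw [hlen] at hi hx
    have hrow : (ofRowLens w hsorted).rowLen i = Nat.count (· ∉ s) (e (s.card - (i + 1))) := by
      rw [rowLen_ofRowLens ⟨i, by simpa [hw] using hi⟩]
      simp [hw, Fin.rev]
    have hcount : Nat.count (· ∈ s) (e (s.card - (i + 1))) = s.card - (i + 1) :=
      Nat.count_nth (hcard (by omega))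
    have hsplit := count_add_count_not (· ∈ s) (e (s.card - (i + 1)))
    have hxe : x = e (s.card - (i + 1)) := by omega
    exact hxe ▸ he (by omega)
  · rw [card_betaSet, hlen]

theorem hookLength_add_gap {μ : YoungDiagram} {i j : ℕ} (h : (i, j) ∈ μ) :
    μ.hookLength (i, j) + gap μ j + i + 1 = μ.rowLen i + μ.colLen 0 := by
  have := mem_iff_lt_rowLen.1 h
  have := mem_iff_lt_colLen.1 h
  have := gap_add_colLen μ j
  rw [hookLength_eq]
  omega

theorem mem_cores_iff {μ : YoungDiagram} {t : ℕ} :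
    μ ∈ cores t ↔ ∀ x, x + t ∈ betaSet μ → x ∈ betaSet μ := by
  constructor
  · intro hμ x hxt
    by_contra hx
    obtain ⟨j, rfl⟩ := notMem_betaSet_iff.1 hx
    obtain ⟨i, _, hx⟩ := mem_betaSet.1 hxt
    have hmem : (i, j) ∈ μ := by
      have := gap_add_colLen μ j
      have := lt_rowLen_iff_lt_colLen (μ := μ) (i := i) (j := j)
      rw [mem_iff_lt_colLen]
      omega
    have := hookLength_add_gap hmem
    exact hμ (i, j) hmem (by omega)
  · rintro h ⟨i, j⟩ hmem rfl
    have hi : i < μ.colLen 0 :=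
      (mem_iff_lt_colLen.1 hmem).trans_le (μ.colLen_anti 0 j (Nat.zero_le j))
    have := hookLength_add_gap hmem
    exact gap_notMem_betaSet μ j (h _ (mem_betaSet.2 ⟨i, hi, by omega⟩))

section Apery

variable {a : ℕ}

/-- `Y` lists the least elements, class by class modulo `a`, of a set of natural numbers that
contains `0` and is closed under addition of `a`, as the Apéry set of a numerical semigroup does.
For an `a`-core that set is the complement of the first-column hook lengths. -/
structure IsApery (Y : ZMod a → ℕ) : Prop where
  natCast_apply : ∀ r, (Y r : ZMod a) = r
  zero : Y 0 = 0

theorem IsApery.forall_lt_imp_lt_iff {Y Y' : ZMod a → ℕ} (hY : IsApery Y) {t : ℕ} :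
    (∀ x : ℕ, x + t < Y' (x + t) → x < Y x) ↔ ∀ r, Y' (r + t) ≤ Y r + t := by
  refine ⟨fun h r => ?_, fun h x hx => Nat.lt_of_add_lt_add_right (hx.trans_le (h x))⟩
  by_contra! hlt
  have hself : Y r < Y (Y r) := h (Y r) (by rwa [hY.natCast_apply])
  rw [hY.natCast_apply] at hself
  exact hself.false

theorem IsApery.ext_of_forall_lt_iff {Y Y' : ZMod a → ℕ} (hY : IsApery Y) (hY' : IsApery Y')
    (h : ∀ x : ℕ, x < Y x ↔ x < Y' x) : Y = Y' := by
  have hle := hY.forall_lt_imp_lt_iff (Y' := Y') (t := 0)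
  have hge := hY'.forall_lt_imp_lt_iff (Y' := Y) (t := 0)
  simp only [Nat.cast_zero, add_zero] at hle hge
  exact funext fun r => le_antisymm (hge.1 (fun x => (h x).1) r) (hle.1 (fun x => (h x).2) r)

/-- The number `a * x_r`, which for an `a`-core is the least natural number in the class `r` modulo
`a` that is not a first-column hook length. -/
def apery (a : ℕ) (μ : YoungDiagram) (r : ZMod a) : ℕ :=
  a * nCoord a μ r.val + r.val

theorem nCoord_mod (a : ℕ) (μ : YoungDiagram) (j : ℕ) : nCoord a μ (j % a) = nCoord a μ j :=
  congrArg card (filter_congr fun x _ => by simp only [Nat.ModEq, Nat.mod_mod])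

theorem apery_natCast (μ : YoungDiagram) (j : ℕ) :
    apery a μ j = a * nCoord a μ j + j % a := by
  rw [apery, ZMod.val_natCast, nCoord_mod]

theorem apery_natCast_eq_mul_xCoord [NeZero a] (μ : YoungDiagram) (j : ℕ) :
    (apery a μ j : ℚ) = a * xCoord a μ j := by
  have ha : (a : ℚ) ≠ 0 := NeZero.ne _
  rw [apery_natCast, xCoord]
  push_cast
  field_simp

theorem natCast_apery [NeZero a] (μ : YoungDiagram) (r : ZMod a) : (apery a μ r : ZMod a) = r := by
  simp [apery]

theorem mem_betaSet_of_le {μ : YoungDiagram} (hμ : μ ∈ cores a) {x y : ℕ} (hxy : x ≡ y [MOD a])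
    (hle : x ≤ y) (hy : y ∈ betaSet μ) : x ∈ betaSet μ := by
  obtain ⟨k, hk⟩ := (Nat.modEq_iff_dvd' hle).1 hxy
  obtain rfl : y = x + a * k := by omega
  clear hk hle hxy
  induction k with
  | zero => simpa using hy
  | succ k ih => exact ih (mem_cores_iff.1 hμ _ (by rwa [mul_add_one, ← add_assoc] at hy))

theorem mem_betaSet_iff_div_lt_nCoord [NeZero a] {μ : YoungDiagram} (hμ : μ ∈ cores a) {x : ℕ} :
    x ∈ betaSet μ ↔ x / a < nCoord a μ x := by
  have hcount : #{y ∈ range x | y ≡ x [MOD a]} = x / a := by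
    rw [← Nat.count_eq_card_filter_range, Nat.count_modEq_card x (Nat.pos_of_neZero a)]
    simp
  constructor
  · intro hx
    rw [← Nat.add_one_le_iff, ← hcount, ← card_cons (a := x) (by simp)]
    refine card_le_card fun y hy => ?_
    simp only [mem_cons, mem_filter, Finset.mem_range] at hy ⊢
    obtain rfl | ⟨hlt, hmod⟩ := hy
    · exact ⟨hx, rfl⟩
    · exact ⟨mem_betaSet_of_le hμ hmod hlt.le hx, hmod⟩
  · contrapose!
    intro hx
    rw [← hcount]
    refine card_le_card fun y hy => ?_
    simp only [mem_filter, Finset.mem_range] at hy ⊢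
    exact ⟨not_le.1 fun hle => hx (mem_betaSet_of_le hμ hy.2.symm hle hy.1), hy.2⟩

theorem mem_betaSet_iff_lt_apery [NeZero a] {μ : YoungDiagram} (hμ : μ ∈ cores a) {x : ℕ} :
    x ∈ betaSet μ ↔ x < apery a μ x := by
  rw [mem_betaSet_iff_div_lt_nCoord hμ, apery_natCast]
  nth_rw 3 [← Nat.div_add_mod x a]
  rw [Nat.add_lt_add_iff_right, Nat.mul_lt_mul_left (Nat.pos_of_neZero a)]

theorem isApery_apery [NeZero a] {μ : YoungDiagram} (hμ : μ ∈ cores a) :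
    IsApery (apery a μ) where
  natCast_apply := natCast_apery μ
  zero := by
    have h := zero_notMem_betaSet μ
    rw [mem_betaSet_iff_lt_apery hμ] at h
    simpa using h

theorem mem_cores_iff_apery_add_le [NeZero a] {μ : YoungDiagram} (hμ : μ ∈ cores a) {t : ℕ} :
    μ ∈ cores t ↔ ∀ r : ZMod a, apery a μ (r + t) ≤ apery a μ r + t := by
  rw [mem_cores_iff, ← (isApery_apery hμ).forall_lt_imp_lt_iff]
  simp only [mem_betaSet_iff_lt_apery hμ, Nat.cast_add]

theorem exists_mem_cores_apery_eq [NeZero a] {Y : ZMod a → ℕ} (hY : IsApery Y) :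
    ∃ μ ∈ cores a, apery a μ = Y := by
  obtain ⟨μ, hμ⟩ := exists_betaSet_eq (s := {x ∈ range (univ.sup Y) | x < Y x}) (by simp [hY.zero])
  have hmem : ∀ x : ℕ, x ∈ betaSet μ ↔ x < Y x := fun x => by
    rw [hμ, mem_filter, Finset.mem_range, and_iff_right_iff_imp]
    exact fun hx => hx.trans_le (le_sup (mem_univ _))
  have hcore : μ ∈ cores a := by
    refine mem_cores_iff.2 fun x => ?_
    rw [hmem, hmem, Nat.cast_add, ZMod.natCast_self, add_zero]
    omega
  refine ⟨μ, hcore, (isApery_apery hcore).ext_of_forall_lt_iff hY fun x => ?_⟩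
  rw [← mem_betaSet_iff_lt_apery hcore, hmem]

theorem bijOn_apery [NeZero a] : Set.BijOn (apery a) (cores a) {Y | IsApery Y} := by
  refine ⟨fun μ hμ => isApery_apery hμ, fun μ hμ ν hν h => betaSet_injective ?_,
    fun Y hY => exists_mem_cores_apery_eq hY⟩
  ext x
  rw [mem_betaSet_iff_lt_apery hμ, mem_betaSet_iff_lt_apery hν, h]

end Apery

section Height

/-- The excess `jb - a (z₀ + ⋯ + z_{j-1})` of the line of slope `b` over `a` times the initial
sums of `z`. -/
def height (a b : ℕ) (z : ℕ → ℕ) (j : ℕ) : ℤ :=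
  j * b - a * ∑ l ∈ range j, (z l : ℤ)

/-- The sequences in which any `d` consecutive entries sum to at most `q`. -/
def windowsLE (d : ℕ) (q : ℚ) : Set (ℕ → ℕ) :=
  {z | ∀ j, ((∑ l ∈ Ico j (j + d), z l : ℕ) : ℚ) ≤ q}

variable {a b : ℕ} {z w : ℕ → ℕ}

theorem height_zero : height a b z 0 = 0 := by
  simp [height]

theorem height_add (j d : ℕ) :
    height a b z (j + d) = height a b z j + d * b - a * ∑ l ∈ Ico j (j + d), (z l : ℤ) := by
  rw [height, height, ← sum_range_add_sum_Ico _ (Nat.le_add_right j d)]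
  push_cast
  ring

theorem height_succ (j : ℕ) : height a b z (j + 1) = height a b z j + b - a * z j := by
  simpa using height_add j 1

theorem intCast_height (j : ℕ) : (height a b z j : ZMod a) = j * b := by
  simp [height]

theorem height_injective [NeZero a] : Function.Injective (height a b) := by
  intro z w h
  funext j
  have hz := height_succ (a := a) (b := b) (z := z) j
  have hw := height_succ (a := a) (b := b) (z := w) j
  have hmul : (a : ℤ) * z j = a * w j := by
    rw [h] at hz
    linarith
  exact_mod_cast mul_left_cancel₀ (NeZero.ne _) hmul

theorem periodic_height_iff [NeZero a] :
    Function.Periodic (height a b z) a ↔ ∀ j, ∑ l ∈ Ico j (j + a), z l = b := by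
  refine forall_congr' fun j => ?_
  have ha : (a : ℤ) ≠ 0 := NeZero.ne _
  rw [height_add, add_sub_assoc, add_eq_left, sub_eq_zero, mul_right_inj' ha]
  norm_cast
  exact eq_comm

theorem mem_cZ_iff [NeZero a] :
    z ∈ cZ a b ↔ Function.Periodic (height a b z) a ∧ ∀ j, 0 ≤ height a b z j := by
  rw [periodic_height_iff]
  refine and_congr_right' (forall_congr' fun j => ?_)
  rw [le_div_iff₀ (Nat.cast_pos.2 (Nat.pos_of_neZero a)), mul_comm, height, sub_nonneg]
  norm_cast

theorem mem_cZ'_iff [NeZero a] : z ∈ cZ' a b ↔ Function.Periodic (height a b z) a := by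
  constructor
  · rintro ⟨hsum, hmod⟩ j
    have hz : ∀ l, z (a + l) = z l := fun l => by rw [hmod, Nat.add_mod_left, ← hmod]
    simp only [height, add_comm j a, sum_range_add, hz]
    rw [← hsum]
    push_cast
    ring
  · intro h
    have hz : Function.Periodic z a := fun j => by
      have hj := height_succ (a := a) (b := b) (z := z) j
      have hja := height_succ (a := a) (b := b) (z := z) (j + a)
      rw [add_right_comm, h, h] at hja
      have hmul : (a : ℤ) * z (j + a) = a * z j := by linarith
      exact_mod_cast mul_left_cancel₀ (NeZero.ne _) hmul
    refine ⟨?_, fun j => (hz.map_mod_nat j).symm⟩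
    simpa [← range_eq_Ico] using periodic_height_iff.1 h 0

theorem mem_windowsLE_iff [NeZero a] {c d : ℕ} :
    z ∈ windowsLE d ((b * d + c) / a) ↔
      ∀ j, height a b z j ≤ height a b z (j + d) + c := by
  refine forall_congr' fun j => ?_
  rw [le_div_iff₀ (Nat.cast_pos.2 (Nat.pos_of_neZero a)), height_add]
  norm_cast
  zify
  constructor <;> intro h <;> linarith

end Height

section Increments

variable {a b : ℕ}

/-- The sequence attached to the partition with Apéry function `Y`. The division is exact when `Y`
is an Apéry function, and the subtraction does not truncate when `Y (r + b) ≤ Y r + b`. -/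
def increments (b : ℕ) (Y : ZMod a → ℕ) (j : ℕ) : ℕ :=
  (Y (j * b) + b - Y ((j + 1) * b)) / a

theorem mul_increments_add {Y : ZMod a → ℕ} (hY : IsApery Y)
    (hb : ∀ r, Y (r + b) ≤ Y r + b) (j : ℕ) :
    a * increments b Y j + Y ((j + 1) * b) = Y (j * b) + b := by
  have hle : Y ((j + 1) * b) ≤ Y (j * b) + b := by
    rw [add_one_mul]
    exact hb _
  have hdvd : a ∣ Y (j * b) + b - Y ((j + 1) * b) := by
    rw [← ZMod.natCast_eq_zero_iff, Nat.cast_sub hle, Nat.cast_add, hY.natCast_apply,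
      hY.natCast_apply]
    ring
  rw [increments, Nat.mul_div_cancel' hdvd, Nat.sub_add_cancel hle]

theorem height_increments {Y : ZMod a → ℕ} (hY : IsApery Y)
    (hb : ∀ r, Y (r + b) ≤ Y r + b) (j : ℕ) :
    height a b (increments b Y) j = Y (j * b) := by
  induction j with
  | zero => simp [height_zero, hY.zero]
  | succ j ih =>
    have hinc := mul_increments_add hY hb j
    rw [height_succ, ih, Nat.cast_add_one]
    zify at hinc
    linarith

theorem exists_natCast_mul_eq [NeZero a] (hab : a.Coprime b) (r : ZMod a) :
    ∃ j : ℕ, (j * b : ZMod a) = r := by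
  refine ⟨(r * (b : ZMod a)⁻¹).val, ?_⟩
  rw [ZMod.natCast_zmod_val, mul_right_comm, mul_assoc, ZMod.coe_mul_inv_eq_one b hab.symm, mul_one]

theorem increments_mem_cZ [NeZero a] {Y : ZMod a → ℕ} (hY : IsApery Y)
    (hb : ∀ r, Y (r + b) ≤ Y r + b) : increments b Y ∈ cZ a b := by
  refine mem_cZ_iff.2 ⟨fun j => ?_, fun j => ?_⟩
  · simp [height_increments hY hb]
  · simp [height_increments hY hb]

theorem exists_increments_eq [NeZero a] (hab : a.Coprime b) {z : ℕ → ℕ} (hz : z ∈ cZ a b) :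
    ∃ Y : ZMod a → ℕ, (IsApery Y ∧ ∀ r, Y (r + b) ≤ Y r + b) ∧ increments b Y = z := by
  obtain ⟨hper, hnonneg⟩ := mem_cZ_iff.1 hz
  set Y : ZMod a → ℕ := fun r => (height a b z (r * (b : ZMod a)⁻¹).val).toNat with hYdef
  have hYmul : ∀ j : ℕ, (Y (j * b) : ℤ) = height a b z j := fun j => by
    rw [hYdef, Int.toNat_of_nonneg (hnonneg _), mul_assoc, ZMod.coe_mul_inv_eq_one b hab.symm,
      mul_one, ZMod.val_natCast, hper.map_mod_nat]
  have hYsucc : ∀ j : ℕ, (Y (j * b + b) : ℤ) = height a b z (j + 1) := fun j => by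
    rw [← hYmul, Nat.cast_add_one, add_one_mul]
  have hY : IsApery Y := by
    refine ⟨fun r => ?_, by simpa [height_zero] using hYmul 0⟩
    obtain ⟨j, rfl⟩ := exists_natCast_mul_eq hab r
    simpa [intCast_height] using congrArg (Int.cast : ℤ → ZMod a) (hYmul j)
  have hb : ∀ r, Y (r + b) ≤ Y r + b := fun r => by
    obtain ⟨j, rfl⟩ := exists_natCast_mul_eq hab r
    zify
    rw [hYmul, hYsucc, height_succ]
    exact sub_le_self _ (by positivity)
  refine ⟨Y, ⟨hY, hb⟩, height_injective (a := a) (b := b) (funext fun j => ?_)⟩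
  rw [height_increments hY hb, hYmul]

theorem bijOn_increments [NeZero a] (hab : a.Coprime b) :
    Set.BijOn (increments b) {Y : ZMod a → ℕ | IsApery Y ∧ ∀ r, Y (r + b) ≤ Y r + b} (cZ a b) := by
  refine ⟨fun Y hY => increments_mem_cZ hY.1 hY.2, fun Y hY Y' hY' h => funext fun r => ?_,
    fun z hz => exists_increments_eq hab hz⟩
  obtain ⟨j, rfl⟩ := exists_natCast_mul_eq hab r
  rw [← Nat.cast_inj (R := ℤ), ← height_increments hY.1 hY.2, h, height_increments hY'.1 hY'.2]

theorem increments_mem_windowsLE_iff [NeZero a] (hab : a.Coprime b) {c d : ℕ}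
    (hd : b * d + c ≡ 0 [MOD a]) {Y : ZMod a → ℕ} (hY : IsApery Y)
    (hb : ∀ r, Y (r + b) ≤ Y r + b) :
    increments b Y ∈ windowsLE d ((b * d + c) / a) ↔ ∀ r, Y (r + c) ≤ Y r + c := by
  have hbdc : (b * d + c : ZMod a) = 0 := by exact_mod_cast (ZMod.natCast_eq_natCast_iff _ _ _).2 hd
  have hshift : ∀ j : ℕ, ((j + d : ℕ) * b + c : ZMod a) = j * b := fun j => by
    rw [Nat.cast_add, ← add_zero (j * b : ZMod a), ← hbdc]
    ring
  have hwindow : increments b Y ∈ windowsLE d ((b * d + c) / a) ↔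
      ∀ j : ℕ, Y ((j + d : ℕ) * b + c) ≤ Y ((j + d : ℕ) * b) + c := by
    rw [mem_windowsLE_iff]
    refine forall_congr' fun j => ?_
    rw [height_increments hY hb, height_increments hY hb, hshift, ← Nat.cast_add, Nat.cast_le]
  rw [hwindow]
  refine ⟨fun h r => ?_, fun h j => h _⟩
  obtain ⟨j, hj⟩ := exists_natCast_mul_eq hab (r + c)
  have hr : ((j + d : ℕ) * b : ZMod a) = r := by
    rw [← add_left_inj (c : ZMod a), hshift, hj]
  exact hr ▸ h j

end Increments

section CorePartitionBijection

variable {a b : ℕ} [NeZero a]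

theorem bijOn_increments_apery (hab : a.Coprime b) :
    Set.BijOn (fun μ => increments b (apery a μ)) (cores a ∩ cores b) (cZ a b) := by
  refine (bijOn_increments hab).comp ?_
  convert (bijOn_apery (a := a)).subset_right
    (r := {Y : ZMod a → ℕ | IsApery Y ∧ ∀ r, Y (r + b) ≤ Y r + b}) (fun Y hY => hY.1) using 1
  ext μ
  refine and_congr_right fun hμ => ?_
  simp [mem_cores_iff_apery_add_le hμ, isApery_apery hμ]

theorem increments_apery_mem_windowsLE_iff (hab : a.Coprime b) {c d : ℕ}
    (hd : b * d + c ≡ 0 [MOD a]) {μ : YoungDiagram} (ha : μ ∈ cores a) (hb : μ ∈ cores b) :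
    increments b (apery a μ) ∈ windowsLE d ((b * d + c) / a) ↔ μ ∈ cores c := by
  rw [mem_cores_iff_apery_add_le ha, increments_mem_windowsLE_iff hab hd (isApery_apery ha)
    ((mem_cores_iff_apery_add_le ha).1 hb)]

theorem bijOn_increments_apery_iInter (hab : a.Coprime b) {ι : Sort*} {c d : ι → ℕ}
    (hd : ∀ i, b * d i + c i ≡ 0 [MOD a]) :
    Set.BijOn (fun μ => increments b (apery a μ)) (cores a ∩ cores b ∩ ⋂ i, cores (c i))
      (cZ a b ∩ ⋂ i, windowsLE (d i) ((b * d i + c i) / a)) := by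
  have hbij := bijOn_increments_apery hab
  convert hbij.subset_right Set.inter_subset_left using 1
  ext μ
  refine and_congr_right fun hμ => ?_
  simp [hbij.mapsTo hμ, increments_apery_mem_windowsLE_iff hab (hd _) hμ.1 hμ.2]

theorem increments_apery_eq_xCoord_sub {μ : YoungDiagram} (ha : μ ∈ cores a) (hb : μ ∈ cores b)
    (j : ℕ) :
    (increments b (apery a μ) j : ℚ) =
      xCoord a μ (j * b) - xCoord a μ ((j + 1) * b) + (b : ℚ) / a := by
  have ha' : (a : ℚ) ≠ 0 := NeZero.ne _
  have hinc := mul_increments_add (isApery_apery ha) ((mem_cores_iff_apery_add_le ha).1 hb) j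
  have hx := apery_natCast_eq_mul_xCoord (a := a) μ (j * b)
  have hx' := apery_natCast_eq_mul_xCoord (a := a) μ ((j + 1) * b)
  push_cast at hx hx'
  rw [← Nat.cast_inj (R := ℚ)] at hinc
  push_cast at hinc
  rw [hx, hx'] at hinc
  field_simp
  linarith

end CorePartitionBijection

section Shift

variable {a b : ℕ} {z : ℕ → ℕ}

/-- The sequence `z` read from its `m`-th entry on. -/
def shift (m : ℕ) (z : ℕ → ℕ) (j : ℕ) : ℕ :=
  z (m + j)

theorem shift_shift (m k : ℕ) (z : ℕ → ℕ) : shift m (shift k z) = shift (k + m) z := by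
  funext j
  simp only [shift, add_assoc]

theorem height_shift (m : ℕ) (z : ℕ → ℕ) (j : ℕ) :
    height a b (shift m z) j = height a b z (m + j) - height a b z m := by
  simp only [height, shift, sum_range_add]
  push_cast
  ring

theorem shift_mem_windowsLE {d : ℕ} {q : ℚ} (hz : z ∈ windowsLE d q) (m : ℕ) :
    shift m z ∈ windowsLE d q := by
  intro j
  simp only [shift, sum_Ico_add, add_right_comm j d m]
  exact hz (j + m)

theorem shift_mem_cZ' [NeZero a] (hz : z ∈ cZ' a b) (m : ℕ) : shift m z ∈ cZ' a b := by
  rw [mem_cZ'_iff] at hz ⊢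
  intro j
  rw [height_shift, height_shift, ← add_assoc, hz]

theorem shift_mul_of_mem_cZ' (hz : z ∈ cZ' a b) (m : ℕ) : shift (a * m) z = z := by
  funext j
  rw [shift, hz.2, Nat.mul_add_mod, ← hz.2]

theorem shift_sub_one_mul_shift [NeZero a] (hz : z ∈ cZ' a b) (m : ℕ) :
    shift ((a - 1) * m) (shift m z) = z := by
  have hm : m + (a - 1) * m = a * m := by
    rw [← one_add_mul, Nat.add_sub_cancel' NeZero.one_le]
  rw [shift_shift, hm, shift_mul_of_mem_cZ' hz]

theorem shift_shift_sub_one_mul [NeZero a] (hz : z ∈ cZ' a b) (m : ℕ) :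
    shift m (shift ((a - 1) * m) z) = z := by
  rw [shift_shift, add_comm, ← shift_shift, shift_sub_one_mul_shift hz]

theorem cZ_subset_cZ' [NeZero a] : cZ a b ⊆ cZ' a b := fun _ hz =>
  mem_cZ'_iff.2 (mem_cZ_iff.1 hz).1

theorem shift_mem_cZ_iff [NeZero a] (hz : z ∈ cZ' a b) {m : ℕ} :
    shift m z ∈ cZ a b ↔ ∀ j, height a b z m ≤ height a b z j := by
  simp only [mem_cZ_iff, mem_cZ'_iff.1 (shift_mem_cZ' hz m), height_shift, sub_nonneg, true_and]
  refine ⟨fun h j => ?_, fun h j => h (m + j)⟩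
  have hle : m ≤ j + m * a := le_add_left (Nat.le_mul_of_pos_right m (Nat.pos_of_neZero a))
  obtain ⟨k, hk⟩ := exists_add_of_le hle
  rw [← (mem_cZ'_iff.1 hz).nat_mul m j, Nat.cast_id, hk]
  exact h k

theorem modEq_of_height_eq (hab : a.Coprime b) {j k : ℕ}
    (h : height a b z j = height a b z k) : j ≡ k [MOD a] := by
  have hcast := congrArg (Int.cast : ℤ → ZMod a) h
  rw [intCast_height, intCast_height] at hcast
  norm_cast at hcast
  exact ((ZMod.natCast_eq_natCast_iff _ _ _).1 hcast).cancel_right_of_coprime hab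

theorem existsUnique_shift_mem_cZ [NeZero a] (hab : a.Coprime b) (hz : z ∈ cZ' a b) :
    ∃! m, m < a ∧ shift m z ∈ cZ a b := by
  simp only [shift_mem_cZ_iff hz]
  obtain ⟨m, hm, hmin⟩ := (range a).exists_min_image (height a b z)
    (nonempty_range_iff.2 (NeZero.ne a))
  have hmin' : ∀ j, height a b z m ≤ height a b z j := fun j => by
    rw [← (mem_cZ'_iff.1 hz).map_mod_nat j]
    exact hmin _ (Finset.mem_range.2 (Nat.mod_lt j (Nat.pos_of_neZero a)))
  refine ⟨m, ⟨Finset.mem_range.1 hm, hmin'⟩, fun k ⟨hk, hmin_k⟩ => ?_⟩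
  exact (modEq_of_height_eq hab (le_antisymm (hmin_k m) (hmin' k))).eq_of_lt_of_lt hk
    (Finset.mem_range.1 hm)

end Shift

section Counting

variable {a b : ℕ}

theorem finite_cZ' [NeZero a] : (cZ' a b).Finite := by
  refine Set.Finite.of_finite_image (f := fun z (i : Fin a) => z i)
    ((Set.finite_Iic fun _ : Fin a => b).subset ?_) fun z hz w hw h => funext fun j => ?_
  · rintro _ ⟨z, hz, rfl⟩ i
    rw [← hz.1]
    exact single_le_sum (f := z) (fun _ _ => Nat.zero_le _) (Finset.mem_range.2 i.2)
  · rw [hz.2 j, hw.2 j]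
    exact congrFun h ⟨j % a, Nat.mod_lt j (Nat.pos_of_neZero a)⟩

theorem bijOn_shift [NeZero a] (hab : a.Coprime b) {W : Set (ℕ → ℕ)}
    (hW : ∀ m, Set.MapsTo (shift m) W W) :
    Set.BijOn (fun p : (ℕ → ℕ) × ℕ => shift ((a - 1) * p.2) p.1)
      ((cZ a b ∩ W) ×ˢ (range a : Set ℕ)) (cZ' a b ∩ W) := by
  refine ⟨?_, ?_, ?_⟩
  · rintro ⟨z, m⟩ ⟨⟨hz, hzW⟩, -⟩
    exact ⟨shift_mem_cZ' (cZ_subset_cZ' hz) _, hW _ hzW⟩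
  · rintro ⟨z, m⟩ ⟨⟨hz : z ∈ cZ a b, -⟩, hm⟩ ⟨w, k⟩ ⟨⟨hw : w ∈ cZ a b, -⟩, hk⟩
      (h : shift ((a - 1) * m) z = shift ((a - 1) * k) w)
    have hzm := shift_shift_sub_one_mul (cZ_subset_cZ' hz) m
    have hwk := shift_shift_sub_one_mul (cZ_subset_cZ' hw) k
    rw [← h] at hwk
    obtain rfl : m = k :=
      (existsUnique_shift_mem_cZ hab (shift_mem_cZ' (cZ_subset_cZ' hz) _)).unique
        ⟨Finset.mem_range.1 hm, hzm.symm ▸ hz⟩ ⟨Finset.mem_range.1 hk, hwk.symm ▸ hw⟩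
    rw [← hzm.symm.trans hwk]
  · rintro z ⟨hz, hzW⟩
    obtain ⟨m, ⟨hm, hmz⟩, -⟩ := existsUnique_shift_mem_cZ hab hz
    exact ⟨(shift m z, m), ⟨⟨hmz, hW m hzW⟩, mem_coe.2 (Finset.mem_range.2 hm)⟩,
      shift_sub_one_mul_shift hz m⟩

theorem ncard_cZ'_inter [NeZero a] (hab : a.Coprime b) {W : Set (ℕ → ℕ)}
    (hW : ∀ m, Set.MapsTo (shift m) W W) :
    (cZ' a b ∩ W).ncard = a * (cZ a b ∩ W).ncard := by
  rw [← (bijOn_shift hab hW).ncard_eq, Set.ncard_prod, Set.ncard_coe_finset, card_range, mul_comm]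

end Counting

theorem mainTheorem4_general {ι : Sort*} {a b : ℕ} (ha : 0 < a) (hab : a.Coprime b)
    (c d : ι → ℕ) (hd : ∀ i, b * d i + c i ≡ 0 [MOD a]) :
    (∃ Φ : (cores a ∩ cores b ∩ ⋂ i, cores (c i) : Set YoungDiagram) ≃
        (cZ a b ∩ ⋂ i, windowsLE (d i) ((b * d i + c i) / a) : Set (ℕ → ℕ)),
      ∀ μ j, ((Φ μ : ℕ → ℕ) j : ℚ) =
        xCoord a μ (j * b) - xCoord a μ ((j + 1) * b) + (b : ℚ) / a) ∧
    (cores a ∩ cores b ∩ ⋂ i, cores (c i)).Finite ∧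
    (cZ' a b ∩ ⋂ i, windowsLE (d i) ((b * d i + c i) / a)).Finite ∧
    ((cores a ∩ cores b ∩ ⋂ i, cores (c i)).ncard : ℚ) =
      1 / (a : ℚ) * (cZ' a b ∩ ⋂ i, windowsLE (d i) ((b * d i + c i) / a)).ncard := by
  have : NeZero a := ⟨ha.ne'⟩
  have hbij := bijOn_increments_apery_iInter hab hd
  have hfin := (finite_cZ' (a := a) (b := b)).inter_of_left
    (⋂ i, windowsLE (d i) ((b * d i + c i) / a))
  have hncard := ncard_cZ'_inter (W := ⋂ i, windowsLE (d i) ((b * d i + c i) / a)) hab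
    fun m z hz => Set.mem_iInter.2 fun i => shift_mem_windowsLE (Set.mem_iInter.1 hz i) m
  refine ⟨⟨hbij.equiv, fun μ => increments_apery_eq_xCoord_sub μ.2.1.1 μ.2.1.2⟩,
    hbij.finite_iff_finite.2 (hfin.subset (Set.inter_subset_inter_left _ cZ_subset_cZ')), hfin, ?_⟩
  rw [hbij.ncard_eq, hncard]
  push_cast
  field_simp

end CorePartitions

theorem mainTheorem4 (a b : ℕ) (ha : 0 < a) (hb : 0 < b) (hab : a.Coprime b)
    (n : ℕ) (c d : Fin n → ℕ) (hc : ∀ i, 0 < c i)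
    (hd : ∀ i, 1 ≤ d i ∧ d i ≤ a ∧ b * d i + c i ≡ 0 [MOD a]) :
    (∃ Φ : simultaneousCores a b c ≃ (cZ a b ∩ windowBounded a b c d : Set (ℕ → ℕ)),
      ∀ (μ : simultaneousCores a b c) (j : ℕ),
        (((Φ μ : ℕ → ℕ) j : ℕ) : ℚ) =
          xCoord a μ (j * b) - xCoord a μ ((j + 1) * b) + (b : ℚ) / a) ∧
    (simultaneousCores a b c).Finite ∧
    (cZ' a b ∩ windowBounded a b c d).Finite ∧
    ((simultaneousCores a b c).ncard : ℚ) =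
      1 / (a : ℚ) * ((cZ' a b ∩ windowBounded a b c d).ncard : ℚ) :=
  mainTheorem4_general ha hab c d fun i => (hd i).2.2
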